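/- Let $\mathbb{H}$ be the quaternions, let $\mathbb{S}$ be the sphere of purely imaginary unit quaternions, and for $I\in\mathbb{S}$ let $\mathbb{C}_I=\{x+Iy : x,y\in\mathbb{R}\}$ with its area measure $dm_I$. A real differentiable function $f:\mathbb{H}\to\mathbb{H}$ is called entire (left) slice regular if $\frac12\left(\frac{\partial}{\partial x}+I\frac{\partial}{\partial y}\right)f(x+Iy)=0$ for all $I\in\mathbb{S}$ and all $x,y\in\mathbb{R}$. For $\alpha>0$, $0<p<\infty$ and $I\in\mathbb{S}$ put $$\|f\|_{p,\alpha,I}=\left(\frac{\alpha p}{2\pi}\int_{\mathbb{C}_I}|f(q)|^p\left(e^{-\alpha|q|^2/2}\right)^p\,dm_I(q)\right)^{1/p}\in[0,\infty].$$ The Fock space of the second kind $\mathcal{F}^{\alpha,p}_{Slice}(\mathbb{H})$ consists of all entire slice regular functions $f$ such that $\|f\|_{p,\alpha,I}<\infty$ for some $I\in\mathbb{S}$, and it is equipped with the norm (quasi-norm if $p<1$) $\|f\|_{\mathcal{F}^{\alpha,p}_{Slice}(\mathbb{H})}=\sup_{I\in\mathbb{S}}\|f\|_{p,\alpha,I}$.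 For $r,q\in\mathbb{H}$ let $$K_\alpha(r,q)=\sum_{k=0}^\infty\frac{\alpha^k r^k\overline{q}^{\,k}}{k!},$$ and let $\mathcal{R}$ be the set of all functions of the form $r\mapsto\sum_{k=1}^n K_\alpha(r,q_k)b_k$ with $n\in\mathbb{N}$ and $q_1,\dots,q_n,b_1,\dots,b_n\in\mathbb{H}$. **Theorem.** For all $\alpha>0$ and $0<p<\infty$, the set $\mathcal{R}$ is dense in $\mathcal{F}^{\alpha,p}_{Slice}(\mathbb{H})$. That is, $\mathcal{R}\subseteq\mathcal{F}^{\alpha,p}_{Slice}(\mathbb{H})$, and for every $f\in\mathcal{F}^{\alpha,p}_{Slice}(\mathbb{H})$ and every $\varepsilon>0$ there is $g\in\mathcal{R}$ with $\|f-g\|_{\mathcal{F}^{\alpha,p}_{Slice}(\mathbb{H})}<\varepsilon$. -/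

import Mathlib

open scoped Quaternion ENNReal
open MeasureTheory

noncomputable section

namespace SliceFock

/-- The sphere `𝕊` of purely imaginary unit quaternions. -/
def imagUnits : Set ℍ[ℝ] := {I | I.re = 0 ∧ ‖I‖ = 1}

/-- The point `x + I y` of the slice `ℂ_I = ℝ + I ℝ`. -/
def slicePoint (I : ℍ[ℝ]) (x y : ℝ) : ℍ[ℝ] := (x : ℍ[ℝ]) + I * (y : ℍ[ℝ])

/-- (Left) slice regular functions on a set `U` (meant for open `U`): `f` is real differentiable at
every point of `U` and, for every `I ∈ 𝕊`,
`½ (∂/∂x + I ∂/∂y) f (x + I y) = 0` at every `x + I y ∈ U`. -/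
def IsSliceRegularOn (f : ℍ[ℝ] → ℍ[ℝ]) (U : Set ℍ[ℝ]) : Prop :=
  (∀ q ∈ U, DifferentiableAt ℝ f q) ∧
    ∀ I ∈ imagUnits, ∀ x y : ℝ, slicePoint I x y ∈ U →
      (1 / 2 : ℝ) • (deriv (fun t : ℝ => f (slicePoint I t y)) x
        + I * deriv (fun t : ℝ => f (slicePoint I x t)) y) = 0

/-- The (quasi-)norm on the slice `ℂ_I`, with values in `[0, ∞]`:
`‖f‖_{p,α,I} = (αp/(2π) ∫_{ℂ_I} |f(q)|^p (e^{-α|q|²/2})^p dm_I(q))^{1/p}`.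
The area measure `dm_I` is transported from `ℂ` by `x + i y ↦ x + I y`. -/
def sliceNorm (α p : ℝ) (I : ℍ[ℝ]) (f : ℍ[ℝ] → ℍ[ℝ]) : ℝ≥0∞ :=
  (ENNReal.ofReal (α * p / (2 * Real.pi)) *
    ∫⁻ z : ℂ, ENNReal.ofReal
      (‖f (slicePoint I z.re z.im)‖ ^ p *
        Real.exp (-α * ‖slicePoint I z.re z.im‖ ^ 2 / 2) ^ p)) ^ (1 / p)

/-- The Fock space of the second kind: entire slice regular functions whose slice norm is finite
for some imaginary unit. -/
def fockSpace (α p : ℝ) : Set (ℍ[ℝ] → ℍ[ℝ]) :=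
  {f | IsSliceRegularOn f Set.univ ∧ ∃ I ∈ imagUnits, sliceNorm α p I f < ∞}

/-- The (quasi-)norm of the Fock space of the second kind: the supremum of the slice norms. -/
def fockNorm (α p : ℝ) (f : ℍ[ℝ] → ℍ[ℝ]) : ℝ≥0∞ :=
  ⨆ I ∈ imagUnits, sliceNorm α p I f

/-- The kernel `K_α(r, q) = ∑_k α^k r^k q̄^k / k!`. -/
def kernel (α : ℝ) (r q : ℍ[ℝ]) : ℍ[ℝ] :=
  ∑' k : ℕ, (α ^ k / (k.factorial : ℝ)) • (r ^ k * star q ^ k)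

/-- The series defining the kernel converges absolutely. -/
theorem summable_norm_kernel (α : ℝ) (r q : ℍ[ℝ]) :
    Summable fun k : ℕ => ‖(α ^ k / (k.factorial : ℝ)) • (r ^ k * star q ^ k)‖ := by
  refine (Real.summable_pow_div_factorial (|α| * (‖r‖ * ‖q‖))).congr fun k => ?_
  rw [norm_smul, norm_mul, norm_pow, norm_pow, norm_star, norm_div, norm_pow, Real.norm_eq_abs,
    Real.norm_natCast, mul_pow, mul_pow]
  ring

/-- The set `𝓡` of finite right-linear combinations `r ↦ ∑_k K_α(r, q_k) b_k`. -/
def kernelSpan (α : ℝ) : Set (ℍ[ℝ] → ℍ[ℝ]) :=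
  {f | ∃ (n : ℕ) (q b : Fin n → ℍ[ℝ]), f = fun r => ∑ k, kernel α r (q k) * b k}

end SliceFock

end

/-
Put `a = α / 2`. On a slice `ℂ_I`, left multiplication makes `ℍ` a complex vector space for which a
slice regular `f` becomes entire, and the slice norm is the `L^p` (quasi-)norm for a Gaussian
probability measure. There, dilations `h (r z)`, `r → 1⁻`, approximate `h` in `L^p`. The
subharmonicity of `|h|^p`, applied after a Gaussian translation, gives the pointwise bound
`|h z| ≤ ‖h‖ exp (a |z|²)`, so dilations grow strictly slower than the weight decays, and Cauchy
estimates make their Taylor polynomials converge by domination. For real `t` the kernel with node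
`t / α` restricts to `exp (t z)`, so the monomial `z ^ n` is the limit of the `n`-th differences
`((exp (t z) - 1) / t) ^ n`, which are combinations of kernels. Finally, the representation formula
recovers `f` on all slices from `f` on one of them, so the Fock norm is bounded by a multiple of a
single slice norm.
-/

namespace SliceFock

open Filter Topology Metric

section SubMeanValue

open Real

variable {E : Type*} [NormedAddCommGroup E] [NormedSpace ℂ E] {R p : ℝ} {c : ℂ}

lemma log_norm_le_circleAverage_log_norm {f : ℂ → ℂ} (hf : AnalyticOnNhd ℂ f (closedBall c |R|))
    (hc : f c ≠ 0) : log ‖f c‖ ≤ circleAverage (fun z => log ‖f z‖) c R := by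
  rcases eq_or_ne R 0 with rfl | hR
  · simp
  rw [hf.circleAverage_log_norm hR hc]
  refine le_add_of_nonneg_left (finsum_nonneg fun u => ?_)
  have hdiv := MeromorphicOn.AnalyticOnNhd.divisor_nonneg hf
  by_cases hu : u ∈ closedBall c |R|
  · refine mul_nonneg (mod_cast hdiv u) ?_
    rw [← log_abs, abs_mul, abs_inv, abs_norm, ← div_eq_mul_inv]
    rw [mem_closedBall, dist_comm, dist_eq_norm] at hu
    rcases (norm_nonneg (c - u)).eq_or_lt with h0 | h0
    · simp [← h0]
    · exact log_nonneg ((one_le_div h0).2 hu)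
  · simp [hu]

lemma exp_circleAverage_le {u : ℂ → ℝ} (hu : CircleIntegrable u c R)
    (hexp : CircleIntegrable (fun z => exp (u z)) c R) :
    exp (circleAverage u c R) ≤ circleAverage (fun z => exp (u z)) c R := by
  have h2π : (0 : ℝ) ≤ 2 * π := by positivity
  have : NeZero (volume.restrict (Set.Ioc 0 (2 * π))) :=
    ⟨by simp [Measure.restrict_eq_zero, pi_pos]⟩
  simp only [circleAverage_eq_intervalAverage, Set.uIoc_of_le h2π]
  exact convexOn_exp.map_average_le continuous_exp.continuousOn isClosed_univ (by simp)
    ((intervalIntegrable_iff_integrableOn_Ioc_of_le h2π).1 hu)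
    ((intervalIntegrable_iff_integrableOn_Ioc_of_le h2π).1 hexp)

lemma circleIntegrable_rpow_norm {f : ℂ → E} (hf : AnalyticOnNhd ℂ f (closedBall c |R|))
    (hp : 0 ≤ p) : CircleIntegrable (fun z => ‖f z‖ ^ p) c R :=
  ((hf.continuousOn.mono sphere_subset_closedBall).norm.rpow_const
    fun _ _ => .inr hp).circleIntegrable'

lemma rpow_norm_le_circleAverage_of_complex {f : ℂ → ℂ} (hf : AnalyticOnNhd ℂ f (closedBall c |R|))
    (hp : 0 < p) : ‖f c‖ ^ p ≤ circleAverage (fun z => ‖f z‖ ^ p) c R := by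
  rcases eq_or_ne (f c) 0 with hc | hc
  · rw [hc, norm_zero, zero_rpow hp.ne']
    exact circleAverage_nonneg_of_nonneg fun _ _ => by positivity
  rcases eq_or_ne R 0 with rfl | hR
  · simp
  have hlog : CircleIntegrable (fun z => p * log ‖f z‖) c R :=
    ((hf.mono sphere_subset_closedBall).meromorphicOn.circleIntegrable_log_norm).const_mul p
  have hexp : (fun z => ‖f z‖ ^ p) =ᶠ[codiscreteWithin (sphere c |R|)]
      fun z => exp (p * log ‖f z‖) := by
    have hzero := hf.preimage_zero_mem_codiscreteWithin hc (mem_closedBall_self (abs_nonneg R))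
      ((convex_closedBall c |R|).isConnected ⟨c, mem_closedBall_self (abs_nonneg R)⟩)
    filter_upwards [codiscreteWithin_mono sphere_subset_closedBall hzero] with z hz
    rw [rpow_def_of_pos (norm_pos_iff.2 hz), mul_comm]
  calc ‖f c‖ ^ p = exp (p * log ‖f c‖) := by rw [rpow_def_of_pos (norm_pos_iff.2 hc), mul_comm]
    _ ≤ exp (p * circleAverage (fun z => log ‖f z‖) c R) := by
        gcongr
        exact log_norm_le_circleAverage_log_norm hf hc
    _ = exp (circleAverage (fun z => p * log ‖f z‖) c R) := by
        rw [← smul_eq_mul, ← circleAverage_fun_smul]; rfl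
    _ ≤ circleAverage (fun z => exp (p * log ‖f z‖)) c R :=
        exp_circleAverage_le hlog
          ((circleIntegrable_rpow_norm hf hp.le).congr_codiscreteWithin hexp)
    _ = circleAverage (fun z => ‖f z‖ ^ p) c R :=
        (circleAverage_congr_codiscreteWithin hexp hR).symm

lemma rpow_norm_le_circleAverage {f : ℂ → E} (hf : AnalyticOnNhd ℂ f (closedBall c |R|))
    (hp : 0 < p) : ‖f c‖ ^ p ≤ circleAverage (fun z => ‖f z‖ ^ p) c R := by
  obtain ⟨φ, hφ, hφc⟩ := exists_dual_vector'' ℂ (f c)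
  have hφf : AnalyticOnNhd ℂ (fun z => φ (f z)) (closedBall c |R|) := φ.comp_analyticOnNhd hf
  calc ‖f c‖ ^ p = ‖φ (f c)‖ ^ p := by simp [hφc]
    _ ≤ circleAverage (fun z => ‖φ (f z)‖ ^ p) c R := rpow_norm_le_circleAverage_of_complex hφf hp
    _ ≤ circleAverage (fun z => ‖f z‖ ^ p) c R :=
        circleAverage_mono (circleIntegrable_rpow_norm hφf hp.le)
          (circleIntegrable_rpow_norm hf hp.le) fun z _ => by
          gcongr
          exact φ.le_of_opNorm_le hφ _ |>.trans_eq (one_mul _)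

lemma rpow_enorm_mul_le_lintegral_circleMap {f : ℂ → E}
    (hf : AnalyticOnNhd ℂ f (closedBall c |R|)) (hp : 0 < p) :
    ‖f c‖ₑ ^ p * ENNReal.ofReal (2 * π) ≤
      ∫⁻ θ in Set.Ioc 0 (2 * π), ‖f (circleMap c R θ)‖ₑ ^ p := by
  have h2π : 0 < 2 * π := by positivity
  have hint := circleIntegrable_rpow_norm hf hp.le
  rw [CircleIntegrable, intervalIntegrable_iff_integrableOn_Ioc_of_le h2π.le] at hint
  have hle := rpow_norm_le_circleAverage hf hp
  rw [circleAverage_def, smul_eq_mul, ← div_eq_inv_mul, le_div_iff₀ h2π,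
    intervalIntegral.integral_of_le h2π.le] at hle
  simp_rw [← ofReal_norm, ENNReal.ofReal_rpow_of_nonneg (norm_nonneg _) hp.le]
  rw [← ENNReal.ofReal_mul (by positivity),
    ← ofReal_integral_eq_lintegral_ofReal hint (.of_forall fun _ => by positivity)]
  exact ENNReal.ofReal_le_ofReal hle

/-- The mean value inequality on the circles through `w` centred at `0`, averaged over `w`. -/
lemma enorm_zero_le_eLpNorm [CompleteSpace E] {f : ℂ → E} (hf : Differentiable ℂ f) {q : ℝ≥0∞}
    (hq : q ≠ 0) (hq' : q ≠ ∞) {μ : Measure ℂ} [IsProbabilityMeasure μ]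
    (hμ : ∀ a : Circle, MeasurePreserving (fun z => (a : ℂ) * z) μ μ) :
    ‖f 0‖ₑ ≤ eLpNorm f q μ := by
  have hp : 0 < q.toReal := ENNReal.toReal_pos hq hq'
  have hmeas : Measurable fun w => ‖f w‖ₑ ^ q.toReal :=
    hf.continuous.enorm.measurable.pow_const _
  have h2π : ENNReal.ofReal (2 * π) ≠ 0 := by simp [pi_pos]
  have hint (θ : ℝ) :
      ∫⁻ w, ‖f (circleMap 0 1 θ * w)‖ₑ ^ q.toReal ∂μ = ∫⁻ w, ‖f w‖ₑ ^ q.toReal ∂μ := by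
    simpa [circleMap] using (hμ (Circle.exp θ)).lintegral_comp hmeas
  rw [eLpNorm_eq_lintegral_rpow_enorm_toReal hq hq', one_div, ENNReal.le_rpow_inv_iff hp,
    ← ENNReal.mul_le_mul_iff_left h2π ENNReal.ofReal_ne_top]
  calc ‖f 0‖ₑ ^ q.toReal * ENNReal.ofReal (2 * π)
      = ∫⁻ _, ‖f 0‖ₑ ^ q.toReal * ENNReal.ofReal (2 * π) ∂μ := by simp
    _ ≤ ∫⁻ w, (∫⁻ θ in Set.Ioc 0 (2 * π), ‖f (circleMap 0 1 θ * w)‖ₑ ^ q.toReal) ∂μ := by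
        refine lintegral_mono fun w => ?_
        simpa using rpow_enorm_mul_le_lintegral_circleMap (f := fun ζ => f (ζ * w)) (c := 0)
          (R := 1) (fun z _ => (hf.comp (differentiable_id.mul_const w)).analyticAt z) hp
    _ = ∫⁻ θ in Set.Ioc 0 (2 * π), ∫⁻ w, ‖f (circleMap 0 1 θ * w)‖ₑ ^ q.toReal ∂μ :=
        lintegral_lintegral_swap (hmeas.comp (by fun_prop)).aemeasurable
    _ = (∫⁻ w, ‖f w‖ₑ ^ q.toReal ∂μ) * ENNReal.ofReal (2 * π) := by simp [hint]

end SubMeanValue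

section LpClosure

variable {X E ι : Type*} [MeasurableSpace X] [NormedAddCommGroup E] {μ : Measure X} {p : ℝ≥0∞}

lemma tendsto_eLpNorm_zero_of_dominated {l : Filter ι} [l.IsCountablyGenerated] {F : ι → X → E}
    {G : X → ℝ} (hp : p ≠ ∞) (hG : MemLp G p μ) (hF : ∀ᶠ i in l, AEStronglyMeasurable (F i) μ)
    (hle : ∀ᶠ i in l, ∀ᵐ x ∂μ, ‖F i x‖ ≤ G x)
    (hlim : ∀ᵐ x ∂μ, Tendsto (fun i => F i x) l (𝓝 0)) :
    Tendsto (fun i => eLpNorm (F i) p μ) l (𝓝 0) := by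
  rcases eq_or_ne p 0 with rfl | hp0
  · simp [tendsto_const_nhds]
  have hpos : 0 < p.toReal := ENNReal.toReal_pos hp0 hp
  have hint : Tendsto (fun i => ∫⁻ x, ‖F i x‖ₑ ^ p.toReal ∂μ) l (𝓝 (∫⁻ _, 0 ∂μ)) := by
    refine tendsto_lintegral_filter_of_dominated_convergence' (fun x => ‖G x‖ₑ ^ p.toReal)
      (hF.mono fun i hi => hi.enorm.pow_const _) (hle.mono fun i hi => hi.mono fun x hx => ?_)
      (lintegral_rpow_enorm_lt_top_of_eLpNorm_lt_top hp0 hp hG.2).ne (hlim.mono fun x hx => ?_)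
    · gcongr
      exact enorm_le_iff_norm_le.2 (hx.trans (Real.le_norm_self _))
    · simpa [hpos] using hx.enorm.ennrpow_const p.toReal
  simp_rw [eLpNorm_eq_lintegral_rpow_enorm_toReal hp0 hp]
  simpa [hpos] using hint.ennrpow_const (1 / p.toReal)

/-- The functions that can be approximated arbitrarily well by elements of `S` in the `L^p`
(quasi-)norm. For `p < 1` the spaces `Lp` of Mathlib carry no topology, so this closure is taken in
the space of all functions. -/
def lpClosure (p : ℝ≥0∞) (μ : Measure X) (S : AddSubmonoid (X → E)) : AddSubmonoid (X → E) where
  carrier := {f | ∀ ε ≠ 0, ∃ g ∈ S, AEStronglyMeasurable (f - g) μ ∧ eLpNorm (f - g) p μ ≤ ε}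
  zero_mem' ε _ := ⟨0, S.zero_mem, by simpa using aestronglyMeasurable_zero, by simp⟩
  add_mem' {f f'} hf hf' ε hε := by
    obtain ⟨η, hη, hadd⟩ := exists_Lp_half E μ p hε
    obtain ⟨g, hg, hm, hle⟩ := hf η hη.ne'
    obtain ⟨g', hg', hm', hle'⟩ := hf' η hη.ne'
    refine ⟨g + g', S.add_mem hg hg', ?_⟩
    rw [add_sub_add_comm]
    exact ⟨hm.add hm', (hadd _ _ hm hm' hle hle').le⟩

lemma lpClosure_le_lpClosure {S T : AddSubmonoid (X → E)} (h : S ≤ lpClosure p μ T) :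
    lpClosure p μ S ≤ lpClosure p μ T := by
  intro f hf ε hε
  obtain ⟨η, hη, hadd⟩ := exists_Lp_half E μ p hε
  obtain ⟨g, hg, hm, hle⟩ := hf η hη.ne'
  obtain ⟨g', hg', hm', hle'⟩ := h hg η hη.ne'
  refine ⟨g', hg', ?_⟩
  rw [← sub_add_sub_cancel f g g']
  exact ⟨hm.add hm', (hadd _ _ hm hm' hle hle').le⟩

lemma mem_lpClosure_of_tendsto {S : AddSubmonoid (X → E)} {l : Filter ι} [l.NeBot] {f : X → E}
    {F : ι → X → E} (hF : ∀ᶠ i in l, F i ∈ S)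
    (hmeas : ∀ᶠ i in l, AEStronglyMeasurable (f - F i) μ)
    (hlim : Tendsto (fun i => eLpNorm (f - F i) p μ) l (𝓝 0)) : f ∈ lpClosure p μ S := by
  intro ε hε
  obtain ⟨i, hi, hm, hle⟩ := (hF.and (hmeas.and (hlim.eventually_le_const hε.bot_lt))).exists
  exact ⟨F i, hi, hm, hle⟩

end LpClosure

section Gaussian

open Real

variable {E : Type*} [NormedAddCommGroup E] {a b : ℝ} {p : ℝ≥0∞}

/-- The rotation invariant Gaussian measure on `ℂ` with density `(b / π) exp (-b |z|²)`. -/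
noncomputable def complexGaussian (b : ℝ) : Measure ℂ :=
  volume.withDensity fun z => ENNReal.ofReal (b / π * exp (-b * ‖z‖ ^ 2))

lemma lintegral_complexGaussian (b : ℝ) (φ : ℂ → ℝ≥0∞) :
    ∫⁻ z, φ z ∂complexGaussian b =
      ∫⁻ z, ENNReal.ofReal (b / π * exp (-b * ‖z‖ ^ 2)) * φ z :=
  lintegral_withDensity_eq_lintegral_mul_non_measurable _ (by fun_prop)
    (.of_forall fun _ => ENNReal.ofReal_lt_top) φ

lemma lintegral_exp_neg_mul_sq_norm (hb : 0 < b) :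
    ∫⁻ z : ℂ, ENNReal.ofReal (exp (-b * ‖z‖ ^ 2)) = ENNReal.ofReal (π / b) := by
  have h := GaussianFourier.integral_rexp_neg_mul_sq_norm (V := ℂ) hb
  rw [Complex.finrank_real_complex, Nat.cast_ofNat, div_self two_ne_zero, rpow_one] at h
  rw [← h, ofReal_integral_eq_lintegral_ofReal (.of_integral_ne_zero (by rw [h]; positivity))
    (.of_forall fun _ => (exp_pos _).le)]

lemma isProbabilityMeasure_complexGaussian (hb : 0 < b) :
    IsProbabilityMeasure (complexGaussian b) where
  measure_univ := by
    rw [← lintegral_one, lintegral_complexGaussian]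
    simp_rw [mul_one, ENNReal.ofReal_mul (show 0 ≤ b / π by positivity)]
    rw [lintegral_const_mul _ (by fun_prop), lintegral_exp_neg_mul_sq_norm hb,
      ← ENNReal.ofReal_mul (by positivity)]
    simp [div_mul_div_cancel₀', hb.ne', pi_ne_zero]

lemma measurePreserving_complexGaussian (L : ℂ ≃ₗᵢ[ℝ] ℂ) :
    MeasurePreserving L (complexGaussian b) (complexGaussian b) where
  measurable := L.continuous.measurable
  map_eq := by
    ext s hs
    have hmeas := L.continuous.measurable
    rw [Measure.map_apply hmeas hs, ← lintegral_indicator_one (hmeas hs),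
      ← lintegral_indicator_one hs, lintegral_complexGaussian, lintegral_complexGaussian]
    refine .trans (lintegral_congr fun z => ?_) (L.measurePreserving.lintegral_comp_emb
      L.toMeasurableEquiv.measurableEmbedding _)
    rw [L.norm_map]
    rfl

lemma lintegral_comp_mul_complexGaussian_le {r : ℝ} (hr0 : 0 < r) (hr1 : r ≤ 1) (hb : 0 ≤ b)
    {φ : ℂ → ℝ≥0∞} (hφ : Measurable φ) :
    ∫⁻ z, φ (r * z) ∂complexGaussian b ≤
      ENNReal.ofReal (r ^ 2)⁻¹ * ∫⁻ z, φ z ∂complexGaussian b := by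
  set ψ : ℂ → ℝ≥0∞ := fun z => ENNReal.ofReal (b / π * exp (-b * ‖z‖ ^ 2)) * φ z
  have hψ : Measurable ψ := by fun_prop
  have hmap : Measure.map (fun z : ℂ => r • z) volume = ENNReal.ofReal (r ^ 2)⁻¹ • volume := by
    rw [Measure.map_addHaar_smul _ hr0.ne', Complex.finrank_real_complex,
      abs_of_pos (by positivity)]
  rw [lintegral_complexGaussian, lintegral_complexGaussian, ← smul_eq_mul,
    ← lintegral_smul_measure, ← hmap, lintegral_map hψ (by fun_prop)]
  refine lintegral_mono fun z => ?_
  have hnorm : ‖(r : ℂ) * z‖ ≤ ‖z‖ := by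
    rw [norm_mul, Complex.norm_of_nonneg hr0.le]
    exact mul_le_of_le_one_left (norm_nonneg z) hr1
  simp only [ψ, Complex.real_smul, neg_mul]
  gcongr

lemma lintegral_translate_complexGaussian (w : ℂ) (φ : ℂ → ℝ≥0∞) :
    ∫⁻ z, ENNReal.ofReal (exp (-(2 * b) * inner ℝ w z)) * φ (w + z) ∂complexGaussian b =
      ENNReal.ofReal (exp (b * ‖w‖ ^ 2)) * ∫⁻ z, φ z ∂complexGaussian b := by
  rw [lintegral_complexGaussian, lintegral_complexGaussian,
    ← lintegral_const_mul' _ _ ENNReal.ofReal_ne_top]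
  refine .trans (lintegral_congr fun z => ?_) (lintegral_add_left_eq_self _ w)
  simp_rw [← mul_assoc]
  rw [← ENNReal.ofReal_mul' (exp_pos _).le, ← ENNReal.ofReal_mul (exp_pos _).le, mul_assoc,
    mul_left_comm (exp (b * _)), ← exp_add, ← exp_add, norm_add_sq_real]
  ring_nf

lemma memLp_exp_mul_sq_norm (hp : p ≠ ∞) {c : ℝ} (hc : c < a) :
    MemLp (fun z : ℂ => exp (c * ‖z‖ ^ 2)) p (complexGaussian (p.toReal * a)) := by
  refine ⟨by fun_prop, ?_⟩
  rcases eq_or_ne p 0 with rfl | hp0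
  · simp
  have hpos : 0 < p.toReal := ENNReal.toReal_pos hp0 hp
  rw [eLpNorm_lt_top_iff_lintegral_rpow_enorm_lt_top hp0 hp, lintegral_complexGaussian]
  have hint := lintegral_exp_neg_mul_sq_norm (mul_pos hpos (sub_pos.2 hc))
  calc ∫⁻ z : ℂ, ENNReal.ofReal (p.toReal * a / π * exp (-(p.toReal * a) * ‖z‖ ^ 2)) *
        ‖exp (c * ‖z‖ ^ 2)‖ₑ ^ p.toReal
      = ∫⁻ z : ℂ, ENNReal.ofReal (p.toReal * a / π) *
          ENNReal.ofReal (exp (-(p.toReal * (a - c)) * ‖z‖ ^ 2)) := lintegral_congr fun z => by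
        rw [enorm_of_nonneg (exp_pos _).le, ENNReal.ofReal_rpow_of_nonneg (exp_pos _).le hpos.le,
          ← exp_mul, ← ENNReal.ofReal_mul' (exp_pos _).le, ← ENNReal.ofReal_mul' (exp_pos _).le,
          mul_assoc, ← exp_add]
        ring_nf
    _ < ∞ := by
        rw [lintegral_const_mul _ (by fun_prop), hint]
        exact ENNReal.mul_lt_top ENNReal.ofReal_lt_top ENNReal.ofReal_lt_top

lemma memLp_exp_mul_norm (hp : p ≠ ∞) (ha : 0 < a) (c : ℝ) :
    MemLp (fun z : ℂ => exp (c * ‖z‖)) p (complexGaussian (p.toReal * a)) := by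
  refine (memLp_exp_mul_sq_norm hp (half_lt_self ha)).of_le_mul (c := exp (c ^ 2 / (2 * a)))
    (by fun_prop) (.of_forall fun z => ?_)
  rw [norm_of_nonneg (exp_pos _).le, norm_of_nonneg (exp_pos _).le,
    ← exp_add, exp_le_exp, ← sub_nonneg]
  have : c ^ 2 / (2 * a) + a / 2 * ‖z‖ ^ 2 - c * ‖z‖ = (a * ‖z‖ - c) ^ 2 / (2 * a) := by
    field_simp
    ring
  rw [this]
  positivity

end Gaussian

section Dilation

variable {E : Type*} [NormedAddCommGroup E] {b : ℝ} {p : ℝ≥0∞}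

lemma eLpNorm_dilation_le (hb : 0 ≤ b) (hp : p ≠ ∞) {f : ℂ → E} (hf : Continuous f) {r : ℝ}
    (hr0 : 0 < r) (hr1 : r ≤ 1) :
    eLpNorm (fun z => f (r * z)) p (complexGaussian b) ≤
      ENNReal.ofReal (r ^ 2)⁻¹ ^ (1 / p.toReal) * eLpNorm f p (complexGaussian b) := by
  rcases eq_or_ne p 0 with rfl | hp0
  · simp
  simp_rw [eLpNorm_eq_lintegral_rpow_enorm_toReal hp0 hp]
  rw [← ENNReal.mul_rpow_of_nonneg _ _ (by positivity)]
  gcongr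
  exact lintegral_comp_mul_complexGaussian_le (φ := fun z => ‖f z‖ₑ ^ p.toReal) hr0 hr1 hb
    (hf.enorm.measurable.pow_const _)

lemma tendsto_eLpNorm_dilation_sub_of_bounded (hb : 0 < b) (hp : p ≠ ∞)
    (g : BoundedContinuousFunction ℂ E) :
    Tendsto (fun r : ℝ => eLpNorm (fun z => g (r * z) - g z) p (complexGaussian b)) (𝓝[<] 1)
      (𝓝 0) := by
  have := isProbabilityMeasure_complexGaussian hb
  refine tendsto_eLpNorm_zero_of_dominated hp (memLp_const (2 * ‖g‖))
    (.of_forall fun r => by fun_prop)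
    (.of_forall fun r => .of_forall fun z => ?_) (.of_forall fun z => ?_)
  · rw [← dist_eq_norm]
    exact g.dist_le_two_norm _ _
  · exact tendsto_nhdsWithin_of_tendsto_nhds (Continuous.tendsto' (by fun_prop) _ _ (by simp))

lemma tendsto_eLpNorm_dilation_sub [NormedSpace ℝ E] (hb : 0 < b) (hp : p ≠ ∞) {h : ℂ → E}
    (hh : Continuous h) (hLp : MemLp h p (complexGaussian b)) :
    Tendsto (fun r : ℝ => eLpNorm (fun z => h (r * z) - h z) p (complexGaussian b)) (𝓝[<] 1)
      (𝓝 0) := by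
  have := isProbabilityMeasure_complexGaussian hb
  refine ENNReal.tendsto_nhds_zero.2 fun ε hε => ?_
  obtain ⟨η, hη, hadd⟩ := exists_Lp_half E (complexGaussian b) p hε.ne'
  obtain ⟨δ, hδ, hadd'⟩ := exists_Lp_half E (complexGaussian b) p hη.ne'
  set K : ℝ≥0∞ := ENNReal.ofReal 4 ^ (1 / p.toReal)
  have hK : K ≠ ∞ := by finiteness
  have hK0 : K ≠ 0 := by simp [K]
  obtain ⟨g, hg, -⟩ := hLp.exists_boundedContinuous_eLpNorm_sub_le hp
    (lt_min hη (ENNReal.div_pos hδ.ne' hK)).ne'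
  have hcont : Continuous (h - ⇑g) := hh.sub g.continuous
  filter_upwards [Ioo_mem_nhdsLT (show (1 / 2 : ℝ) < 1 by norm_num),
    (tendsto_eLpNorm_dilation_sub_of_bounded hb hp g).eventually_le_const hδ] with r hr hgr
  have hdil : eLpNorm (fun z => (h - ⇑g) (r * z)) p (complexGaussian b) ≤ δ := by
    have hr2 : (r ^ 2)⁻¹ ≤ 4 := by
      rw [inv_le_comm₀ (pow_pos (by linarith [hr.1]) 2) (by norm_num)]
      nlinarith [hr.1]
    calc eLpNorm (fun z => (h - ⇑g) (r * z)) p (complexGaussian b)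
        ≤ K * (δ / K) := (eLpNorm_dilation_le hb.le hp hcont (by linarith [hr.1]) hr.2.le).trans
          (mul_le_mul' (by simp only [K]; gcongr) (hg.trans (min_le_right _ _)))
      _ = δ := ENNReal.mul_div_cancel hK0 hK
  have hsum := hadd' _ _ (by fun_prop) (by fun_prop) hdil hgr
  have hsub := hadd _ _ (by fun_prop) (by fun_prop) hsum.le
    ((eLpNorm_sub_comm g h p _).trans_le (hg.trans (min_le_left _ _)))
  refine (congrArg (eLpNorm · p _) ?_).trans_le hsub.le
  ext z
  simp only [Pi.add_apply, Pi.sub_apply]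
  abel

end Dilation

section Entire

open Real

variable {E : Type*} [NormedAddCommGroup E] [NormedSpace ℂ E] {a b : ℝ}
  {p : ℝ≥0∞} {h u : ℂ → E}

/-- The polynomials with coefficients in `E`, as functions. -/
def polynomials (E : Type*) [NormedAddCommGroup E] [NormedSpace ℂ E] : AddSubmonoid (ℂ → E) :=
  AddSubmonoid.closure (Set.range fun (nv : ℕ × E) z => z ^ nv.1 • nv.2)

lemma taylor_mem_polynomials (u : ℂ → E) (N : ℕ) :
    (fun z => ∑ n ∈ Finset.range N, (n.factorial : ℂ)⁻¹ • z ^ n • iteratedDeriv n u 0) ∈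
      polynomials E := by
  have hsum := AddSubmonoid.sum_mem (polynomials E) (t := Finset.range N)
    (f := fun n z => z ^ n • ((n.factorial : ℂ)⁻¹ • iteratedDeriv n u 0))
    fun n _ => AddSubmonoid.subset_closure ⟨(n, _), rfl⟩
  convert hsum using 2 with z
  simp only [Finset.sum_apply]
  exact Finset.sum_congr rfl fun n _ => smul_comm _ _ _

variable [CompleteSpace E]

lemma enorm_zero_le_eLpNorm_complexGaussian (hb : 0 < b) (hp0 : p ≠ 0) (hp : p ≠ ∞)
    (hh : Differentiable ℂ h) : ‖h 0‖ₑ ≤ eLpNorm h p (complexGaussian b) :=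
  have := isProbabilityMeasure_complexGaussian hb
  enorm_zero_le_eLpNorm hh hp0 hp fun ζ => measurePreserving_complexGaussian (rotation ζ)

lemma enorm_le_eLpNorm_complexGaussian (ha : 0 < a) (hp0 : p ≠ 0) (hp : p ≠ ∞)
    (hh : Differentiable ℂ h) (w : ℂ) :
    ‖h w‖ₑ ≤ ENNReal.ofReal (exp (a * ‖w‖ ^ 2)) *
      eLpNorm h p (complexGaussian (p.toReal * a)) := by
  have hpos : 0 < p.toReal := ENNReal.toReal_pos hp0 hp
  -- `exp(-a|w|²) g` is the Weyl translate of `h` by `w`, which acts isometrically.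
  set g : ℂ → E := fun z => Complex.exp (-(2 * a) * (star w * z)) • h (w + z)
  have hg : Differentiable ℂ g := by fun_prop
  have hnorm (z : ℂ) : ‖g z‖ₑ ^ p.toReal =
      ENNReal.ofReal (exp (-(2 * (p.toReal * a)) * inner ℝ w z)) * ‖h (w + z)‖ₑ ^ p.toReal := by
    rw [enorm_smul, ENNReal.mul_rpow_of_nonneg _ _ hpos.le, ← ofReal_norm, Complex.norm_exp,
      ENNReal.ofReal_rpow_of_nonneg (exp_pos _).le hpos.le, ← exp_mul, Complex.inner]
    congr 3
    simp
    ring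
  have heq : eLpNorm g p (complexGaussian (p.toReal * a)) = ENNReal.ofReal (exp (a * ‖w‖ ^ 2)) *
      eLpNorm h p (complexGaussian (p.toReal * a)) := by
    simp_rw [eLpNorm_eq_lintegral_rpow_enorm_toReal hp0 hp, hnorm]
    rw [lintegral_translate_complexGaussian w fun z => ‖h z‖ₑ ^ p.toReal,
      ENNReal.mul_rpow_of_nonneg _ _ (by positivity),
      ENNReal.ofReal_rpow_of_nonneg (exp_pos _).le (by positivity), ← exp_mul]
    congr 3
    field_simp
  rw [← heq]
  simpa [g] using enorm_zero_le_eLpNorm_complexGaussian (mul_pos hpos ha) hp0 hp hg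

lemma norm_le_eLpNorm_mul_exp (ha : 0 < a) (hp0 : p ≠ 0) (hp : p ≠ ∞) (hh : Differentiable ℂ h)
    (hLp : MemLp h p (complexGaussian (p.toReal * a))) (w : ℂ) :
    ‖h w‖ ≤ (eLpNorm h p (complexGaussian (p.toReal * a))).toReal * exp (a * ‖w‖ ^ 2) := by
  have hle := enorm_le_eLpNorm_complexGaussian ha hp0 hp hh w
  have hfin := ENNReal.mul_ne_top (ENNReal.ofReal_ne_top (r := exp (a * ‖w‖ ^ 2)))
    hLp.eLpNorm_ne_top
  simpa [ENNReal.toReal_mul, (exp_pos _).le, mul_comm] using ENNReal.toReal_mono hfin hle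

lemma norm_taylor_term_le (hu : Differentiable ℂ u) {t M : ℝ} (ht : 0 < t) {z : ℂ}
    (hM : ∀ w ∈ sphere 0 (t * ‖z‖), ‖u w‖ ≤ M) (n : ℕ) :
    ‖(n.factorial : ℂ)⁻¹ • z ^ n • iteratedDeriv n u 0‖ ≤ M * t⁻¹ ^ n := by
  rcases eq_or_ne z 0 with rfl | hz
  · rcases n with _ | n
    · simpa using hM 0 (by simp)
    · simpa using mul_nonneg ((norm_nonneg _).trans (hM 0 (by simp))) (by positivity)
  have hcauchy := Complex.norm_iteratedDeriv_le_of_forall_mem_sphere_norm_le n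
    (by positivity) hu.diffContOnCl hM
  rw [norm_smul, norm_smul, norm_pow, norm_inv, Complex.norm_natCast]
  calc (n.factorial : ℝ)⁻¹ * (‖z‖ ^ n * ‖iteratedDeriv n u 0‖)
      ≤ (n.factorial : ℝ)⁻¹ * (‖z‖ ^ n * (n.factorial * M / (t * ‖z‖) ^ n)) := by gcongr
    _ = M * t⁻¹ ^ n := by
        have := norm_pos_iff.2 hz
        rw [mul_pow, inv_pow]
        field_simp

lemma norm_sub_taylor_le (hu : Differentiable ℂ u) {t M : ℝ} (ht : 1 < t) {z : ℂ}
    (hM : ∀ w ∈ sphere 0 (t * ‖z‖), ‖u w‖ ≤ M) (N : ℕ) :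
    ‖u z - ∑ n ∈ Finset.range N, (n.factorial : ℂ)⁻¹ • z ^ n • iteratedDeriv n u 0‖ ≤
      M * (1 - t⁻¹)⁻¹ := by
  have ht' : t⁻¹ < 1 := inv_lt_one_of_one_lt₀ ht
  have hM0 : 0 ≤ M := (norm_nonneg _).trans (hM (t * z) (by simp [abs_of_pos, one_pos.trans ht]))
  have hsum := Complex.hasSum_taylorSeries_of_entire hu 0 z
  simp only [sub_zero] at hsum
  refine ((hasSum_nat_add_iff' N).2 hsum).norm_le_of_bounded
    ((hasSum_geometric_of_lt_one (by positivity) ht').mul_left M) fun n => ?_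
  refine (norm_taylor_term_le hu (by positivity) hM (n + N)).trans ?_
  gcongr M * ?_
  exact pow_le_pow_of_le_one (by positivity) ht'.le (by lia)

lemma mem_lpClosure_polynomials_of_norm_le (hp : p ≠ ∞) (hu : Differentiable ℂ u) {c C : ℝ}
    (hc : c < a) (hC : ∀ z, ‖u z‖ ≤ C * exp (c * ‖z‖ ^ 2)) :
    u ∈ lpClosure p (complexGaussian (p.toReal * a)) (polynomials E) := by
  obtain ⟨t, hta, ht⟩ : ∃ t : ℝ, c * t ^ 2 < a ∧ 1 < t := by
    have htendsto : Tendsto (fun t : ℝ => c * t ^ 2) (𝓝[>] 1) (𝓝 c) :=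
      tendsto_nhdsWithin_of_tendsto_nhds (Continuous.tendsto' (by fun_prop) _ _ (by simp))
    exact ((htendsto.eventually_lt_const hc).and self_mem_nhdsWithin).exists
  set T : ℕ → ℂ → E := fun N z =>
    ∑ n ∈ Finset.range N, (n.factorial : ℂ)⁻¹ • z ^ n • iteratedDeriv n u 0
  have hmeas (N : ℕ) : AEStronglyMeasurable (u - T N) (complexGaussian (p.toReal * a)) :=
    (hu.continuous.sub (by fun_prop)).aestronglyMeasurable
  have hbound (N : ℕ) (z : ℂ) :
      ‖(u - T N) z‖ ≤ C * (1 - t⁻¹)⁻¹ * exp (c * t ^ 2 * ‖z‖ ^ 2) := by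
    refine (norm_sub_taylor_le hu ht (M := C * exp (c * (t * ‖z‖) ^ 2))
      (fun w hw => ?_) N).trans_eq (by ring_nf)
    rw [mem_sphere_zero_iff_norm] at hw
    simpa only [hw] using hC w
  have hlim (z : ℂ) : Tendsto (fun N => (u - T N) z) atTop (𝓝 0) := by
    have hsum := (Complex.hasSum_taylorSeries_of_entire hu 0 z).tendsto_sum_nat
    simpa [T] using hsum.const_sub (u z)
  exact mem_lpClosure_of_tendsto (.of_forall (taylor_mem_polynomials u)) (.of_forall hmeas)
    (tendsto_eLpNorm_zero_of_dominated hp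
      ((memLp_exp_mul_sq_norm hp hta).const_mul (C * (1 - t⁻¹)⁻¹)) (.of_forall hmeas)
      (.of_forall fun N => .of_forall (hbound N)) (.of_forall hlim))

lemma mem_lpClosure_polynomials (ha : 0 < a) (hp0 : p ≠ 0) (hp : p ≠ ∞) (hh : Differentiable ℂ h)
    (hLp : MemLp h p (complexGaussian (p.toReal * a))) :
    h ∈ lpClosure p (complexGaussian (p.toReal * a)) (polynomials E) := by
  have hcont (r : ℝ) : Continuous fun z => h (r * z) := hh.continuous.comp (by fun_prop)
  have hmeas (r : ℝ) :
      AEStronglyMeasurable (h - fun z => h (r * z)) (complexGaussian (p.toReal * a)) :=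
    (hh.continuous.sub (hcont r)).aestronglyMeasurable
  have hdil : ∀ᶠ r : ℝ in 𝓝[<] 1,
      (fun z => h (r * z)) ∈ lpClosure p (complexGaussian (p.toReal * a)) (polynomials E) := by
    filter_upwards [Ioo_mem_nhdsLT zero_lt_one] with r hr
    refine mem_lpClosure_polynomials_of_norm_le (c := a * r ^ 2)
      (C := (eLpNorm h p (complexGaussian (p.toReal * a))).toReal) hp (by fun_prop)
      (mul_lt_of_lt_one_right ha (pow_lt_one₀ hr.1.le hr.2 two_ne_zero)) fun z => ?_
    refine (norm_le_eLpNorm_mul_exp ha hp0 hp hh hLp (r * z)).trans_eq ?_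
    rw [norm_mul, Complex.norm_real, mul_pow, norm_eq_abs, sq_abs, mul_assoc]
  refine lpClosure_le_lpClosure le_rfl (mem_lpClosure_of_tendsto hdil (.of_forall hmeas) ?_)
  exact (tendsto_eLpNorm_dilation_sub (mul_pos (ENNReal.toReal_pos hp0 hp) ha) hp hh.continuous
    hLp).congr fun r => eLpNorm_sub_comm _ _ _ _

end Entire

section PowerSeries

lemma eq_of_hasSum_pow_smul {𝕜 E : Type*} [NontriviallyNormedField 𝕜] [NormedAddCommGroup E]
    [NormedSpace 𝕜 E] {a b : ℕ → E} {g : 𝕜 → E} (ha : ∀ x, HasSum (fun n => x ^ n • a n) (g x))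
    (hb : ∀ x, HasSum (fun n => x ^ n • b n) (g x)) : a = b := by
  have hasFPowerSeriesAt {c : ℕ → E} (hc : ∀ x, HasSum (fun n => x ^ n • c n) (g x)) :
      HasFPowerSeriesAt g (fun n => ContinuousMultilinearMap.mkPiRing 𝕜 (Fin n) (c n)) 0 :=
    hasFPowerSeriesAt_iff.2 (.of_forall fun x => by
      simpa [FormalMultilinearSeries.coeff] using hc x)
  ext n
  simpa [FormalMultilinearSeries.coeff] using congrArg (fun P => P.coeff n)
    ((hasFPowerSeriesAt ha).eq_formalMultilinearSeries (hasFPowerSeriesAt hb))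

lemma differentiable_of_hasSum_pow_smul {𝕜 A E : Type*} [RCLike 𝕜] [NormedRing A] [NormOneClass A]
    [NormedAlgebra 𝕜 A] [NormedAddCommGroup E] [NormedSpace 𝕜 E] [CompleteSpace E] [Module A E]
    [IsBoundedSMul A E] [IsScalarTower 𝕜 A E] {a : ℕ → E} {f : A → E}
    (ha : ∀ q, HasSum (fun n => q ^ n • a n) (f q)) : Differentiable 𝕜 f := by
  set P : FormalMultilinearSeries 𝕜 A E := fun n =>
    ((ContinuousLinearMap.lsmul 𝕜 A).flip (a n)).compContinuousMultilinearMap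
      (ContinuousMultilinearMap.mkPiAlgebraFin 𝕜 n A)
  have hP (n : ℕ) : ‖P n‖ ≤ ‖a n‖ := by
    refine (ContinuousLinearMap.norm_compContinuousMultilinearMap_le _ _).trans ?_
    rw [ContinuousMultilinearMap.norm_mkPiAlgebraFin, mul_one]
    refine ContinuousLinearMap.opNorm_le_bound _ (norm_nonneg _) fun q => ?_
    rw [mul_comm]
    exact norm_smul_le q (a n)
  have hradius : P.radius = ∞ := ENNReal.eq_top_of_forall_nnreal_le fun r => by
    refine P.le_radius_of_tendsto (l := 0) ?_
    have hterm := (ha (algebraMap 𝕜 A (r : ℝ))).summable.tendsto_atTop_zero.norm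
    simp only [← map_pow, algebraMap_smul, norm_smul, norm_algebraMap', Real.norm_of_nonneg,
      NNReal.coe_nonneg, pow_nonneg, norm_zero, mul_comm _ ‖a _‖] at hterm
    exact squeeze_zero (fun n => by positivity) (fun n => by gcongr; exact hP n) hterm
  have hf : HasFPowerSeriesOnBall f P 0 ∞ :=
    { r_le := hradius.ge
      r_pos := ENNReal.zero_lt_top
      hasSum := fun {q} _ => by simpa [P] using ha q }
  exact fun q => (hf.analyticAt_of_mem (by simp)).differentiableAt

end PowerSeries

section Slice

variable {I J : ℍ[ℝ]} {f g : ℍ[ℝ] → ℍ[ℝ]}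

lemma imagUnits_mul_self (hI : I ∈ imagUnits) : I * I = -1 := by
  rw [← sq, Quaternion.sq_eq_neg_normSq.2 hI.1, Quaternion.normSq_eq_norm_mul_self, hI.2]
  simp

lemma inv_norm_smul_im_mem_imagUnits {q : ℍ[ℝ]} (hq : q.im ≠ 0) : ‖q.im‖⁻¹ • q.im ∈ imagUnits :=
  ⟨by simp, norm_smul_inv_norm hq⟩

lemma imagUnits_nonempty : imagUnits.Nonempty :=
  ⟨_, inv_norm_smul_im_mem_imagUnits (q := ⟨0, 1, 0, 0⟩) fun h =>
    one_ne_zero (congrArg QuaternionAlgebra.imI h)⟩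

/-- The embedding `x + i y ↦ x + I y` of `ℂ` onto the slice `ℂ_I`. -/
noncomputable def sliceHom (I : ℍ[ℝ]) (hI : I ∈ imagUnits) : ℂ →ₐ[ℝ] ℍ[ℝ] :=
  Complex.liftAux I (imagUnits_mul_self hI)

lemma sliceHom_eq_slicePoint (hI : I ∈ imagUnits) (z : ℂ) :
    sliceHom I hI z = slicePoint I z.re z.im := by
  rw [sliceHom, Complex.liftAux_apply, slicePoint, Quaternion.mul_coe_eq_smul]
  rfl

lemma sliceHom_ofReal (hI : I ∈ imagUnits) (x : ℝ) : sliceHom I hI x = (x : ℍ[ℝ]) :=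
  (sliceHom I hI).commutes x

lemma sliceHom_conj (hI : I ∈ imagUnits) (z : ℂ) :
    sliceHom I hI (star z) = star (sliceHom I hI z) := by
  simp [sliceHom_eq_slicePoint, slicePoint, Quaternion.star_eq_neg.2 hI.1,
    Quaternion.coe_commutes]

lemma norm_sliceHom (hI : I ∈ imagUnits) (z : ℂ) : ‖sliceHom I hI z‖ = ‖z‖ := by
  have hcoe : ((‖sliceHom I hI z‖ * ‖sliceHom I hI z‖ : ℝ) : ℍ[ℝ]) = (‖z‖ * ‖z‖ : ℝ) := by
    rw [← Quaternion.normSq_eq_norm_mul_self, ← Quaternion.self_mul_star, ← sliceHom_conj,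
      ← map_mul, Complex.star_def, Complex.mul_conj, Complex.normSq_eq_norm_sq, sq,
      sliceHom_ofReal]
  exact (mul_self_inj (norm_nonneg _) (norm_nonneg _)).1 (Quaternion.coe_injective hcoe)

lemma exists_sliceHom_eq (q : ℍ[ℝ]) : ∃ (I : ℍ[ℝ]) (hI : I ∈ imagUnits) (z : ℂ),
    sliceHom I hI z = q := by
  rcases eq_or_ne q.im 0 with him | him
  · obtain ⟨I, hI⟩ := imagUnits_nonempty
    refine ⟨I, hI, q.re, ?_⟩
    rw [sliceHom_ofReal, ← add_zero (q.re : ℍ[ℝ]), ← him, Quaternion.re_add_im]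
  · refine ⟨_, inv_norm_smul_im_mem_imagUnits him, ⟨q.re, ‖q.im‖⟩, ?_⟩
    rw [sliceHom_eq_slicePoint, slicePoint, Quaternion.mul_coe_eq_smul,
      smul_inv_smul₀ (norm_ne_zero_iff.2 him), Quaternion.re_add_im]

lemma continuous_sliceHom (hI : I ∈ imagUnits) : Continuous (sliceHom I hI) :=
  (sliceHom I hI).toLinearMap.continuous_of_finiteDimensional

lemma differentiable_comp_sliceHom (hI : I ∈ imagUnits) (hf : Differentiable ℝ f) :
    Differentiable ℝ fun z => f (sliceHom I hI z) :=
  hf.comp (sliceHom I hI).toLinearMap.toContinuousLinearMap.differentiable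

/-- The complex structure on `ℍ` given by left multiplication with the elements of the slice `ℂ_I`.
It is not an instance since it depends on `I`; slice regular functions are exactly the real
differentiable ones that become holomorphic on every slice for it. -/
noncomputable abbrev sliceNormedSpace (I : ℍ[ℝ]) (hI : I ∈ imagUnits) : NormedSpace ℂ ℍ[ℝ] where
  toModule := Module.compHom ℍ[ℝ] (sliceHom I hI).toRingHom
  norm_smul_le z q := by
    change ‖sliceHom I hI z * q‖ ≤ _
    rw [norm_mul, norm_sliceHom]

lemma slice_smul_def (hI : I ∈ imagUnits) (z : ℂ) (q : ℍ[ℝ]) :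
    letI := sliceNormedSpace I hI
    z • q = sliceHom I hI z * q := rfl

lemma differentiableAt_slice_iff (hI : I ∈ imagUnits) {h : ℂ → ℍ[ℝ]} {z : ℂ} :
    (letI := sliceNormedSpace I hI
     DifferentiableAt ℂ h z) ↔
      DifferentiableAt ℝ h z ∧ fderiv ℝ h z Complex.I = I * fderiv ℝ h z 1 := by
  let := sliceNormedSpace I hI
  have : IsScalarTower ℝ ℂ ℍ[ℝ] := ⟨fun x z q => by
    simp only [slice_smul_def, map_smul, smul_mul_assoc]⟩
  have hsmul (q : ℍ[ℝ]) : Complex.I • q = I * q := by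
    simp [slice_smul_def, sliceHom_eq_slicePoint, slicePoint]
  rw [← hsmul]
  refine ⟨fun hh => ⟨hh.restrictScalars ℝ, ?_⟩, fun ⟨hh, hCR⟩ => ?_⟩
  · simp [hh.fderiv_restrictScalars ℝ]
  · refine (differentiableAt_iff_restrictScalars ℝ hh).2
      ⟨ContinuousLinearMap.toSpanSingleton ℂ (fderiv ℝ h z 1), ?_⟩
    refine ContinuousLinearMap.coe_injective (Complex.basisOneI.ext fun i => ?_)
    fin_cases i <;> simp [hCR]

lemma deriv_slicePoint_re (hI : I ∈ imagUnits) (hf : Differentiable ℝ f) (x y : ℝ) :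
    deriv (fun t => f (slicePoint I t y)) x = fderiv ℝ (fun z => f (sliceHom I hI z)) ⟨x, y⟩ 1 := by
  rw [← (differentiable_comp_sliceHom hI hf _).lineDeriv_eq_fderiv, lineDeriv]
  simpa [sliceHom_eq_slicePoint] using
    (deriv_comp_const_add (fun t => f (slicePoint I t y)) x 0).symm

lemma deriv_slicePoint_im (hI : I ∈ imagUnits) (hf : Differentiable ℝ f) (x y : ℝ) :
    deriv (fun t => f (slicePoint I x t)) y =
      fderiv ℝ (fun z => f (sliceHom I hI z)) ⟨x, y⟩ Complex.I := by
  rw [← (differentiable_comp_sliceHom hI hf _).lineDeriv_eq_fderiv, lineDeriv]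
  simpa [sliceHom_eq_slicePoint] using
    (deriv_comp_const_add (fun t => f (slicePoint I x t)) y 0).symm

lemma isSliceRegularOn_univ_iff : IsSliceRegularOn f Set.univ ↔
    Differentiable ℝ f ∧ ∀ (I : ℍ[ℝ]) (hI : I ∈ imagUnits),
      letI := sliceNormedSpace I hI
      Differentiable ℂ fun z => f (sliceHom I hI z) := by
  simp only [IsSliceRegularOn, Set.mem_univ, forall_const, ← Differentiable.eq_1]
  refine and_congr_right fun hf => forall₂_congr fun I hI => ?_
  have hcr (a b : ℍ[ℝ]) : (1 / 2 : ℝ) • (a + I * b) = 0 ↔ b = I * a := by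
    rw [smul_eq_zero_iff_right (by norm_num), add_eq_zero_iff_eq_neg]
    constructor
    · rintro rfl
      rw [mul_neg, ← mul_assoc, imagUnits_mul_self hI, neg_one_mul, neg_neg]
    · rintro rfl
      rw [← mul_assoc, imagUnits_mul_self hI, neg_one_mul, neg_neg]
  have hfI := differentiable_comp_sliceHom hI hf
  simp only [Differentiable, differentiableAt_slice_iff hI, deriv_slicePoint_re hI hf,
    deriv_slicePoint_im hI hf, hcr]
  exact ⟨fun h z => ⟨hfI z, h z.re z.im⟩, fun h x y => (h ⟨x, y⟩).2⟩

lemma IsSliceRegularOn.exists_hasSum (hf : IsSliceRegularOn f Set.univ) :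
    ∃ a : ℕ → ℍ[ℝ], ∀ q, HasSum (fun n => q ^ n * a n) (f q) := by
  have expansion (I : ℍ[ℝ]) (hI : I ∈ imagUnits) : ∃ a : ℕ → ℍ[ℝ],
      ∀ z, HasSum (fun n => sliceHom I hI z ^ n * a n) (f (sliceHom I hI z)) := by
    let := sliceNormedSpace I hI
    refine ⟨fun n => (n.factorial : ℂ)⁻¹ • iteratedDeriv n (fun z => f (sliceHom I hI z)) 0,
      fun z => ?_⟩
    have := Complex.hasSum_taylorSeries_of_entire ((isSliceRegularOn_univ_iff.1 hf).2 I hI) 0 z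
    refine this.congr_fun fun n => ?_
    rw [sub_zero, smul_comm, slice_smul_def _ (z ^ n), map_pow]
  have real_expansion {I : ℍ[ℝ]} (hI : I ∈ imagUnits) {a : ℕ → ℍ[ℝ]}
      (ha : ∀ z, HasSum (fun n => sliceHom I hI z ^ n * a n) (f (sliceHom I hI z))) (x : ℝ) :
      HasSum (fun n => x ^ n • a n) (f x) := by
    simpa only [sliceHom_ofReal, ← Quaternion.coe_pow, Quaternion.coe_mul_eq_smul] using ha x
  obtain ⟨I₀, hI₀⟩ := imagUnits_nonempty
  obtain ⟨a, ha⟩ := expansion I₀ hI₀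
  refine ⟨a, fun q => ?_⟩
  obtain ⟨I, hI, z, rfl⟩ := exists_sliceHom_eq q
  obtain ⟨b, hb⟩ := expansion I hI
  rw [eq_of_hasSum_pow_smul (real_expansion hI₀ ha) (real_expansion hI hb)]
  exact hb z

lemma isSliceRegularOn_of_hasSum {a : ℕ → ℍ[ℝ]} (ha : ∀ q, HasSum (fun n => q ^ n * a n) (f q)) :
    IsSliceRegularOn f Set.univ := by
  refine isSliceRegularOn_univ_iff.2 ⟨differentiable_of_hasSum_pow_smul ha, fun I hI => ?_⟩
  let := sliceNormedSpace I hI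
  refine differentiable_of_hasSum_pow_smul (a := a) fun z => ?_
  simpa only [slice_smul_def, map_pow] using ha (sliceHom I hI z)

lemma IsSliceRegularOn.continuous_comp_sliceHom (hf : IsSliceRegularOn f Set.univ)
    (hI : I ∈ imagUnits) : Continuous fun z => f (sliceHom I hI z) :=
  (differentiable_comp_sliceHom hI (isSliceRegularOn_univ_iff.1 hf).1).continuous

lemma IsSliceRegularOn.sub (hf : IsSliceRegularOn f Set.univ) (hg : IsSliceRegularOn g Set.univ) :
    IsSliceRegularOn (f - g) Set.univ := by
  obtain ⟨a, ha⟩ := hf.exists_hasSum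
  obtain ⟨b, hb⟩ := hg.exists_hasSum
  exact isSliceRegularOn_of_hasSum (a := a - b) fun q => by
    simpa only [Pi.sub_apply, mul_sub] using (ha q).sub (hb q)

lemma sliceHom_eq_of_slice (hI : I ∈ imagUnits) (hJ : J ∈ imagUnits) (z : ℂ) :
    sliceHom I hI z = (1 / 2 : ℝ) •
      ((1 - I * J) * sliceHom J hJ z + (1 + I * J) * sliceHom J hJ (star z)) := by
  have hJJ : I * J * (J * z.im) = -(I * z.im) := by
    rw [mul_assoc, ← mul_assoc J, imagUnits_mul_self hJ, neg_one_mul, mul_neg]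
  simp only [sliceHom_eq_slicePoint, slicePoint, Complex.star_def, Complex.conj_re,
    Complex.conj_im, Quaternion.coe_neg, sub_mul, add_mul, mul_add, one_mul, mul_neg, hJJ]
  module

lemma IsSliceRegularOn.apply_sliceHom (hf : IsSliceRegularOn f Set.univ) (hI : I ∈ imagUnits)
    (hJ : J ∈ imagUnits) (z : ℂ) : f (sliceHom I hI z) = (1 / 2 : ℝ) •
      ((1 - I * J) * f (sliceHom J hJ z) + (1 + I * J) * f (sliceHom J hJ (star z))) := by
  obtain ⟨a, ha⟩ := hf.exists_hasSum
  refine (ha (sliceHom I hI z)).unique ?_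
  refine ((((ha (sliceHom J hJ z)).mul_left (1 - I * J)).add
    ((ha (sliceHom J hJ (star z))).mul_left (1 + I * J))).const_smul (1 / 2 : ℝ)).congr_fun
      fun n => ?_
  rw [← map_pow, sliceHom_eq_of_slice hI hJ, smul_mul_assoc, add_mul, mul_assoc, mul_assoc,
    map_pow, star_pow, map_pow]

end Slice

section FockNorm

variable {I J : ℍ[ℝ]} {f : ℍ[ℝ] → ℍ[ℝ]} {p : ℝ≥0∞}

lemma sliceNorm_eq_eLpNorm (hp0 : p ≠ 0) (hp : p ≠ ∞) (α : ℝ) (hI : I ∈ imagUnits)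
    (f : ℍ[ℝ] → ℍ[ℝ]) : sliceNorm α p.toReal I f =
      eLpNorm (fun z => f (sliceHom I hI z)) p (complexGaussian (p.toReal * (α / 2))) := by
  rw [eLpNorm_eq_lintegral_rpow_enorm_toReal hp0 hp, lintegral_complexGaussian, sliceNorm,
    ← lintegral_const_mul' _ _ ENNReal.ofReal_ne_top]
  congr 1
  refine lintegral_congr fun z => ?_
  rw [← sliceHom_eq_slicePoint hI, norm_sliceHom, ← ofReal_norm,
    ENNReal.ofReal_rpow_of_nonneg (norm_nonneg _) ENNReal.toReal_nonneg, ← Real.exp_mul,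
    ENNReal.ofReal_mul' (Real.exp_pos _).le, ENNReal.ofReal_mul' (Real.exp_pos _).le]
  ring_nf

lemma eLpNorm_comp_star {E : Type*} [NormedAddCommGroup E] {h : ℂ → E} (hh : Continuous h)
    (p : ℝ≥0∞) (b : ℝ) :
    eLpNorm (fun z => h (star z)) p (complexGaussian b) = eLpNorm h p (complexGaussian b) :=
  eLpNorm_comp_measurePreserving hh.aestronglyMeasurable
    (measurePreserving_complexGaussian Complex.conjLIE)

lemma IsSliceRegularOn.eLpNorm_comp_sliceHom_le (hf : IsSliceRegularOn f Set.univ)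
    (hI : I ∈ imagUnits) (hJ : J ∈ imagUnits) (p : ℝ≥0∞) (b : ℝ) :
    eLpNorm (fun z => f (sliceHom I hI z)) p (complexGaussian b) ≤
      ENNReal.LpAddConst p *
        (2 * eLpNorm (fun z => f (sliceHom J hJ z)) p (complexGaussian b)) := by
  have hIJ : ‖I * J‖ = 1 := by rw [norm_mul, hI.2, hJ.2, one_mul]
  have norm_le {c : ℍ[ℝ]} (hc : ‖c‖ ≤ ‖(1 : ℍ[ℝ])‖ + ‖I * J‖) (q : ℍ[ℝ]) :
      ‖(1 / 2 : ℝ) • (c * q)‖ ≤ ‖q‖ := by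
    rw [norm_one, hIJ] at hc
    rw [norm_smul, norm_mul, Real.norm_of_nonneg (by norm_num)]
    nlinarith [norm_nonneg q]
  have hcont := hf.continuous_comp_sliceHom hJ
  have hrep : (fun z => f (sliceHom I hI z)) =
      (fun z => (1 / 2 : ℝ) • ((1 - I * J) * f (sliceHom J hJ z))) +
        fun z => (1 / 2 : ℝ) • ((1 + I * J) * f (sliceHom J hJ (star z))) :=
    funext fun z => (hf.apply_sliceHom hI hJ z).trans (smul_add _ _ _)
  rw [hrep]
  have hsmul (c : ℍ[ℝ]) {h : ℂ → ℍ[ℝ]} (hh : Continuous h) :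
      AEStronglyMeasurable (fun z => (1 / 2 : ℝ) • (c * h z)) (complexGaussian b) := by fun_prop
  refine (eLpNorm_add_le' (hsmul _ hcont) (hsmul _ (hcont.comp continuous_star)) p).trans ?_
  rw [two_mul]
  refine mul_le_mul_right (add_le_add ?_ ((?_ : _ ≤ _).trans_eq (eLpNorm_comp_star hcont p b))) _
  · exact eLpNorm_mono fun z => norm_le (norm_sub_le _ _) _
  · exact eLpNorm_mono fun z => norm_le (norm_add_le _ _) _

lemma IsSliceRegularOn.fockNorm_le (hf : IsSliceRegularOn f Set.univ) (hp0 : p ≠ 0) (hp : p ≠ ∞)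
    (α : ℝ) (hI : I ∈ imagUnits) : fockNorm α p.toReal f ≤ ENNReal.LpAddConst p *
      (2 * eLpNorm (fun z => f (sliceHom I hI z)) p (complexGaussian (p.toReal * (α / 2)))) :=
  iSup₂_le fun _ hJ => (sliceNorm_eq_eLpNorm hp0 hp α hJ f).trans_le
    (hf.eLpNorm_comp_sliceHom_le hJ hI p _)

end FockNorm

section Kernel

variable {α a : ℝ} {p : ℝ≥0∞} {I : ℍ[ℝ]} {f g : ℍ[ℝ] → ℍ[ℝ]}

lemma hasSum_kernel_mul (α : ℝ) (r q b : ℍ[ℝ]) :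
    HasSum (fun n : ℕ => r ^ n * ((α ^ n / (n.factorial : ℝ)) • (star q ^ n * b)))
      (kernel α r q * b) := by
  refine ((summable_norm_kernel α r q).of_norm.hasSum.mul_right b).congr_fun fun n => ?_
  rw [mul_smul_comm, smul_mul_assoc, mul_assoc]

lemma isSliceRegularOn_of_mem_kernelSpan (hg : g ∈ kernelSpan α) :
    IsSliceRegularOn g Set.univ := by
  obtain ⟨n, q, b, rfl⟩ := hg
  refine isSliceRegularOn_of_hasSum
    (a := fun m => ∑ k, (α ^ m / (m.factorial : ℝ)) • (star (q k) ^ m * b k)) fun r => ?_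
  simpa only [Finset.mul_sum] using hasSum_sum fun k _ => hasSum_kernel_mul α r (q k) (b k)

lemma norm_kernel_le (α : ℝ) (r q : ℍ[ℝ]) : ‖kernel α r q‖ ≤ Real.exp (|α| * ‖q‖ * ‖r‖) := by
  have hexp : HasSum (fun k : ℕ => (|α| * ‖q‖ * ‖r‖) ^ k / (k.factorial : ℝ))
      (Real.exp (|α| * ‖q‖ * ‖r‖)) := by
    rw [Real.exp_eq_exp_ℝ]
    exact NormedSpace.expSeries_div_hasSum_exp _
  refine tsum_of_norm_bounded hexp fun k => le_of_eq ?_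
  rw [norm_smul, norm_mul, norm_pow, norm_pow, norm_star, norm_div, norm_pow,
    Real.norm_eq_abs, Real.norm_natCast, mul_pow, mul_pow]
  ring

lemma memLp_comp_sliceHom_of_mem_kernelSpan (hg : g ∈ kernelSpan α) (ha : 0 < a) (hp : p ≠ ∞)
    (hI : I ∈ imagUnits) :
    MemLp (fun z => g (sliceHom I hI z)) p (complexGaussian (p.toReal * a)) := by
  have hterm (q b : ℍ[ℝ]) : MemLp (fun z => kernel α (sliceHom I hI z) q * b) p
      (complexGaussian (p.toReal * a)) := by
    have hcont := (isSliceRegularOn_of_hasSum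
      fun r => hasSum_kernel_mul α r q b).continuous_comp_sliceHom hI
    refine (memLp_exp_mul_norm hp ha (|α| * ‖q‖)).of_le_mul (c := ‖b‖)
      hcont.aestronglyMeasurable (.of_forall fun z => ?_)
    rw [norm_mul, mul_comm, Real.norm_of_nonneg (Real.exp_pos _).le, ← norm_sliceHom hI]
    gcongr
    exact norm_kernel_le _ _ _
  obtain ⟨n, q, b, rfl⟩ := hg
  exact memLp_finsetSum _ fun k _ => hterm (q k) (b k)

lemma kernelSpan_subset_fockSpace (hα : 0 < α) (hp0 : p ≠ 0) (hp : p ≠ ∞) :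
    kernelSpan α ⊆ fockSpace α p.toReal := by
  intro g hg
  obtain ⟨I, hI⟩ := imagUnits_nonempty
  refine ⟨isSliceRegularOn_of_mem_kernelSpan hg, I, hI, ?_⟩
  rw [sliceNorm_eq_eLpNorm hp0 hp α hI]
  exact (memLp_comp_sliceHom_of_mem_kernelSpan hg (half_pos hα) hp hI).2

/-- The restrictions to the slice `ℂ_I` of the finite combinations of kernels. -/
def sliceKernels (α : ℝ) (I : ℍ[ℝ]) (hI : I ∈ imagUnits) : AddSubmonoid (ℂ → ℍ[ℝ]) where
  carrier := {h | ∃ g ∈ kernelSpan α, h = fun z => g (sliceHom I hI z)}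
  zero_mem' := ⟨0, ⟨0, ![], ![], by ext1; simp⟩, rfl⟩
  add_mem' := by
    rintro _ _ ⟨_, ⟨m, q, b, rfl⟩, rfl⟩ ⟨_, ⟨n, q', b', rfl⟩, rfl⟩
    exact ⟨_, ⟨m + n, Fin.append q q', Fin.append b b', rfl⟩, by ext1; simp [Fin.sum_univ_add]⟩

lemma kernel_sliceHom_ofReal (α : ℝ) (hI : I ∈ imagUnits) (z : ℂ) (t : ℝ) :
    kernel α (sliceHom I hI z) t = sliceHom I hI (Complex.exp ((α * t : ℝ) * z)) := by
  have hexp : HasSum (fun k : ℕ => ((α * t : ℝ) * z) ^ k / (k.factorial : ℂ))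
      (Complex.exp ((α * t : ℝ) * z)) := by
    rw [Complex.exp_eq_exp_ℂ]
    exact NormedSpace.expSeries_div_hasSum_exp _
  rw [← (hexp.map (sliceHom I hI) (continuous_sliceHom hI)).tsum_eq, kernel]
  refine tsum_congr fun k => ?_
  have hterm : ((α * t : ℝ) * z) ^ k / (k.factorial : ℂ)
      = (α ^ k / (k.factorial : ℝ)) • (z ^ k * (t : ℂ) ^ k) := by
    rw [Complex.real_smul]
    push_cast
    ring
  rw [Function.comp_apply, hterm, map_smul, map_mul, map_pow, map_pow, sliceHom_ofReal,
    Quaternion.star_coe]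

lemma diffQuot_exp_pow_mem_sliceKernels (hα : α ≠ 0) (hI : I ∈ imagUnits) (n : ℕ) (v : ℍ[ℝ])
    (t : ℝ) : (fun z => sliceHom I hI (((Complex.exp (t * z) - 1) / t) ^ n) * v) ∈
      sliceKernels α I hI := by
  set c : ℕ → ℝ := fun k => (-1) ^ (n - k) * n.choose k / t ^ n
  refine ⟨_, ⟨n + 1, fun k => ((k * t / α : ℝ) : ℍ[ℝ]), fun k => c k • v, rfl⟩, funext fun z => ?_⟩
  have hbinom : ((Complex.exp (t * z) - 1) / t) ^ n =
      ∑ k ∈ Finset.range (n + 1), c k • Complex.exp ((k * t : ℝ) * z) := by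
    rw [div_pow, sub_eq_add_neg, add_pow, Finset.sum_div]
    refine Finset.sum_congr rfl fun k _ => ?_
    rw [← Complex.exp_nat_mul, Complex.real_smul]
    push_cast [c]
    ring_nf
  rw [hbinom, map_sum, Finset.sum_mul, Finset.sum_range]
  refine Finset.sum_congr rfl fun k _ => ?_
  rw [kernel_sliceHom_ofReal, map_smul, mul_smul_comm, smul_mul_assoc, mul_div_cancel₀ _ hα]

lemma tendsto_diffQuot_exp (z : ℂ) :
    Tendsto (fun t : ℝ => (Complex.exp (t * z) - 1) / t) (𝓝[≠] 0) (𝓝 z) := by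
  have hderiv : HasDerivAt (fun t : ℝ => Complex.exp (t * z)) z 0 := by
    simpa using ((hasDerivAt_id (0 : ℝ)).ofReal_comp.mul_const z).cexp
  refine (hasDerivAt_iff_tendsto_slope_zero.1 hderiv).congr fun t => ?_
  simp [div_eq_inv_mul]

lemma norm_diffQuot_exp_le {t : ℝ} (ht : |t| ≤ 1) (z : ℂ) :
    ‖(Complex.exp (t * z) - 1) / t‖ ≤ Real.exp (2 * ‖z‖) := by
  have htz : ‖(t : ℂ) * z‖ = |t| * ‖z‖ := by rw [norm_mul, Complex.norm_real, Real.norm_eq_abs]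
  rw [norm_div, Complex.norm_real, Real.norm_eq_abs]
  refine div_le_of_le_mul₀ (abs_nonneg t) (Real.exp_pos _).le ?_
  calc ‖Complex.exp (t * z) - 1‖ ≤ |t| * ‖z‖ * Real.exp (|t| * ‖z‖) := by
        simpa [htz] using Complex.norm_exp_sub_sum_le_norm_mul_exp (t * z) 1
    _ ≤ |t| * Real.exp ‖z‖ * Real.exp (1 * ‖z‖) := by
        gcongr
        linarith [Real.add_one_le_exp ‖z‖]
    _ = Real.exp (2 * ‖z‖) * |t| := by
        rw [mul_assoc, ← Real.exp_add, mul_comm]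
        ring_nf

lemma pow_mul_mem_lpClosure_sliceKernels (hα : α ≠ 0) (ha : 0 < a) (hp : p ≠ ∞)
    (hI : I ∈ imagUnits) (n : ℕ) (v : ℍ[ℝ]) : (fun z => sliceHom I hI (z ^ n) * v) ∈
      lpClosure p (complexGaussian (p.toReal * a)) (sliceKernels α I hI) := by
  have hφ := continuous_sliceHom hI
  have hmeas (t : ℝ) : AEStronglyMeasurable ((fun z => sliceHom I hI (z ^ n) * v) -
      fun z => sliceHom I hI (((Complex.exp (t * z) - 1) / t) ^ n) * v)
      (complexGaussian (p.toReal * a)) :=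
    (((hφ.comp (by fun_prop)).mul continuous_const).sub
      ((hφ.comp (by fun_prop)).mul continuous_const)).aestronglyMeasurable
  have hnorm {w z : ℂ} (hw : ‖w‖ ≤ Real.exp (2 * ‖z‖)) :
      ‖sliceHom I hI (w ^ n) * v‖ ≤ Real.exp (n * 2 * ‖z‖) * ‖v‖ := by
    rw [norm_mul, norm_sliceHom, norm_pow, mul_assoc, Real.exp_nat_mul]
    gcongr
  have hid (z : ℂ) : ‖z‖ ≤ Real.exp (2 * ‖z‖) := by
    linarith [Real.add_one_le_exp (2 * ‖z‖), norm_nonneg z]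
  refine mem_lpClosure_of_tendsto (l := 𝓝[≠] (0 : ℝ))
    (.of_forall (diffQuot_exp_pow_mem_sliceKernels hα hI n v)) (.of_forall hmeas)
    (tendsto_eLpNorm_zero_of_dominated hp
      (((memLp_exp_mul_norm hp ha (n * 2)).mul_const ‖v‖).const_mul 2) (.of_forall hmeas)
      ?_ (.of_forall fun z => ?_))
  · have hsmall : ∀ᶠ t : ℝ in 𝓝[≠] 0, |t| ≤ 1 :=
      nhdsWithin_le_nhds (continuous_abs.tendsto' 0 0 abs_zero |>.eventually_le_const one_pos)
    filter_upwards [hsmall] with t ht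
    refine .of_forall fun z => (norm_sub_le _ _).trans ?_
    linarith [hnorm (hid z), hnorm (norm_diffQuot_exp_le ht z)]
  · have := ((hφ.tendsto _).comp ((tendsto_diffQuot_exp z).pow n)).mul_const v
    simpa using this.const_sub (sliceHom I hI (z ^ n) * v)

lemma IsSliceRegularOn.comp_sliceHom_mem_lpClosure (hf : IsSliceRegularOn f Set.univ)
    (hα : α ≠ 0) (ha : 0 < a) (hp0 : p ≠ 0) (hp : p ≠ ∞) (hI : I ∈ imagUnits)
    (hLp : MemLp (fun z => f (sliceHom I hI z)) p (complexGaussian (p.toReal * a))) :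
    (fun z => f (sliceHom I hI z)) ∈
      lpClosure p (complexGaussian (p.toReal * a)) (sliceKernels α I hI) := by
  let := sliceNormedSpace I hI
  refine lpClosure_le_lpClosure (AddSubmonoid.closure_le.2 ?_)
    (mem_lpClosure_polynomials ha hp0 hp ((isSliceRegularOn_univ_iff.1 hf).2 I hI) hLp)
  rintro _ ⟨⟨n, v⟩, rfl⟩
  exact pow_mul_mem_lpClosure_sliceKernels hα ha hp hI n v

lemma exists_mem_kernelSpan_fockNorm_sub_lt (hα : 0 < α) (hp0 : p ≠ 0) (hp : p ≠ ∞)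
    (hf : f ∈ fockSpace α p.toReal) {ε : ℝ≥0∞} (hε : ε ≠ 0) :
    ∃ g ∈ kernelSpan α, fockNorm α p.toReal (f - g) < ε := by
  obtain ⟨hreg, I, hI, hfin⟩ := hf
  rw [sliceNorm_eq_eLpNorm hp0 hp α hI] at hfin
  have hdense := hreg.comp_sliceHom_mem_lpClosure hα.ne' (half_pos hα) hp0 hp hI
    ⟨(hreg.continuous_comp_sliceHom hI).aestronglyMeasurable, hfin⟩
  obtain ⟨η, hη, hηε⟩ := ENNReal.exists_nnreal_pos_mul_lt
    (a := ENNReal.LpAddConst p * 2)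
    (ENNReal.mul_ne_top (ENNReal.LpAddConst_lt_top p).ne ENNReal.ofNat_ne_top) hε
  obtain ⟨_, ⟨g, hg, rfl⟩, -, hle⟩ := hdense η (by simpa using hη.ne')
  refine ⟨g, hg, lt_of_le_of_lt ?_ hηε⟩
  refine ((hreg.sub (isSliceRegularOn_of_mem_kernelSpan hg)).fockNorm_le hp0 hp α hI).trans ?_
  rw [mul_comm (η : ℝ≥0∞), mul_assoc]
  gcongr
  exact hle

end Kernel

end SliceFock

theorem theorem4p6 (α p : ℝ) (hα : 0 < α) (hp : 0 < p) :
    SliceFock.kernelSpan α ⊆ SliceFock.fockSpace α p ∧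
      ∀ f ∈ SliceFock.fockSpace α p, ∀ ε : ENNReal, 0 < ε →
        ∃ g ∈ SliceFock.kernelSpan α, SliceFock.fockNorm α p (f - g) < ε := by
  obtain ⟨q, hq0, hq, rfl⟩ : ∃ q : ℝ≥0∞, q ≠ 0 ∧ q ≠ ∞ ∧ q.toReal = p :=
    ⟨.ofReal p, by simpa using hp, ENNReal.ofReal_ne_top, ENNReal.toReal_ofReal hp.le⟩
  exact ⟨SliceFock.kernelSpan_subset_fockSpace hα hq0 hq, fun f hf ε hε =>
    SliceFock.exists_mem_kernelSpan_fockNorm_sub_lt hα hq0 hq hf hε.ne'⟩
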